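/- Conventions. An \emph{interior algebra} is a Boolean algebra $A$ with an operation $g$ such that $g(1)=1$, $g(ab)=g(a)g(b)$, $g(a)\le a$ and $g(g(a))=g(a)$. A variety is a class of algebras defined by equations, and $\mathbf{Eq}(K)$ is the variety generated by $K$. For a Heyting algebra $L$ let $\mathrm{Fr}(L)\supseteq L$ be its free Boolean extension (the Boolean subalgebra of the power set of the set of prime ideals of $L$ generated by the Stone embedding of $L$), let $$g_L\big((-u_1+v_1)\cdots(-u_n+v_n)\big)=(u_1\Rightarrow v_1)\cdots(u_n\Rightarrow v_n)\qquad(u_i,v_i\in L),$$ and let $\mathcal B(L)=\langle \mathrm{Fr}(L),g_L\rangle$, an interior algebra. For a Heyting homomorphism $h\colon L\to M$ let $\mathcal B(h)\colon\mathcal B(L)\to\mathcal B(M)$ be the unique homomorphism of interior algebras that extends $h$. For a variety $V$ of Heyting algebras put $\rho^*(V)=\mathbf{Eq}(\{\mathcal B(L):L\in V\})$. If $V$ is a variety and $A\in V$ is finitely presented in $V$, a \emph{unifier} of $A$ in $V$ is a pair $\langle u,M\rangle$ where $M\in V$ is finitely presented in $V$ and projective in $V$ (with respect to surjective homomorphisms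 between members of $V$), and $u\colon A\to M$ is a homomorphism; $A$ is \emph{unifiable} in $V$ if it has a unifier in $V$. A unifier $\langle u,M\rangle$ is \emph{more general} than $\langle v,N\rangle$, written $\langle u,M\rangle\succcurlyeq\langle v,N\rangle$, if $v=h\circ u$ for some homomorphism $h\colon M\to N$. An \emph{isomorphism} of unifiers $\langle u,M\rangle\to\langle v,N\rangle$ is an isomorphism $h\colon M\to N$ with $v=h\circ u$. Theorem. Let $V$ be a variety of Heyting algebras and let $L\in V$ be finitely presented and unifiable in $V$. Then $\mathcal B(L)$ is finitely presented in $\rho^*(V)$, and $\tau(\langle u,M\rangle)=\langle\mathcal B(u),\mathcal B(M)\rangle$ defines a map $\tau$ from the unifiers of $L$ in $V$ to the unifiers of $\mathcal B(L)$ in $\rho^*(V)$, such that: 1. $\tau$ is injective, where, as free Boolean extensions are determined only up to isomorphism, pairs are compared up to isomorphism: for unifiers $\langle u,M\rangle$, $\langle v,N\rangle$ of $L$ in $V$, each isomorphism of unifiers $\varphi\colon\tau(\langle u,M\rangle)\to\tau(\langle v,N\rangle)$ is $\mathcal B(\psi)$ for a unique isomorphism of unifiers $\psi\colon\langle u,M\rangle\to\langle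 v,N\rangle$; moreover, if $M=N$ and $\mathcal B(u)=\mathcal B(v)$, then $u=v$. 2. $\tau$ preserves $\succcurlyeq$: if $\langle u,M\rangle\succcurlyeq\langle v,N\rangle$, then $\tau(\langle u,M\rangle)\succcurlyeq\tau(\langle v,N\rangle)$. 3. If $\rho^*(V)$ is locally finite (finitely generated subalgebras of its members are finite), then $\tau$ is surjective up to isomorphism: each unifier of $\mathcal B(L)$ in $\rho^*(V)$ is isomorphic to $\tau(\langle u,M\rangle)$ for some unifier $\langle u,M\rangle$ of $L$ in $V$. -/

import Mathlib

open CategoryTheory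

universe u v w

namespace HeytingUnification

/-! ### Interior algebras -/

/-- An interior algebra: a Boolean algebra with an interior operator. -/
class InteriorAlgebra (A : Type u) extends BooleanAlgebra A where
  /-- The interior operator. -/
  int : A → A
  int_top : int ⊤ = ⊤
  int_inf : ∀ a b : A, int (a ⊓ b) = int a ⊓ int b
  int_le : ∀ a : A, int a ≤ a
  int_int : ∀ a : A, int (int a) = int a

/-- Homomorphisms of interior algebras. (Complements are preserved automatically by bounded
lattice homomorphisms between Boolean algebras.) -/
structure InteriorHom (A : Type u) (B : Type v) [InteriorAlgebra A] [InteriorAlgebra B] extends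
    BoundedLatticeHom A B where
  map_int' : ∀ a : A, toFun (InteriorAlgebra.int a) = InteriorAlgebra.int (toFun a)

namespace InteriorHom

variable {A : Type u} {B : Type v} {C : Type w} [InteriorAlgebra A] [InteriorAlgebra B]
  [InteriorAlgebra C]

instance : FunLike (InteriorHom A B) A B where
  coe f := f.toFun
  coe_injective f g h := by
    obtain ⟨f, _⟩ := f
    obtain ⟨g, _⟩ := g
    congr
    exact DFunLike.coe_injective h

instance : BoundedLatticeHomClass (InteriorHom A B) A B where
  map_sup f := f.map_sup'
  map_inf f := f.map_inf'
  map_top f := f.map_top'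
  map_bot f := f.map_bot'

theorem map_int (f : InteriorHom A B) (a : A) :
    f (InteriorAlgebra.int a) = InteriorAlgebra.int (f a) := f.map_int' a

/-- The identity homomorphism. -/
def id (A : Type u) [InteriorAlgebra A] : InteriorHom A A :=
  { BoundedLatticeHom.id A with map_int' := fun _ => rfl }

/-- Composition of homomorphisms. -/
def comp (g : InteriorHom B C) (f : InteriorHom A B) : InteriorHom A C :=
  { g.toBoundedLatticeHom.comp f.toBoundedLatticeHom with
    map_int' := fun a => (congrArg g (f.map_int a)).trans (g.map_int (f a)) }

end InteriorHom

/-- The category of interior algebras. -/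
structure IntAlg where
  /-- The underlying interior algebra. -/
  carrier : Type u
  [str : InteriorAlgebra carrier]

attribute [instance] IntAlg.str

namespace IntAlg

instance : CoeSort IntAlg.{u} (Type u) := ⟨IntAlg.carrier⟩

/-- Morphisms of interior algebras. -/
@[ext]
structure Hom (X Y : IntAlg.{u}) where
  /-- The underlying homomorphism. -/
  hom' : InteriorHom X Y

instance : Category IntAlg.{u} where
  Hom X Y := Hom X Y
  id X := ⟨InteriorHom.id X⟩
  comp f g := ⟨g.hom'.comp f.hom'⟩

instance : ConcreteCategory IntAlg.{u} (fun X Y => InteriorHom X Y) where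
  hom f := f.hom'
  ofHom f := ⟨f⟩

end IntAlg

/-! ### The free Boolean extension of a bounded distributive lattice -/

section FreeBooleanExtension

variable (L : Type u) [DistribLattice L] [BoundedOrder L]
variable {M : Type v} [DistribLattice M] [BoundedOrder M]
variable {N : Type w} [DistribLattice N] [BoundedOrder N]

/-- The set of prime ideals. -/
abbrev PrimeIdeals : Type u := {I : Order.Ideal L // I.IsPrime}

/-- The Stone embedding of a bounded distributive lattice into the power set of its set of prime
ideals. -/
def stone : BoundedLatticeHom L (Set (PrimeIdeals L)) where
  toFun a := {P | a ∉ P.1}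
  map_sup' a b := by
    ext P
    change (a ⊔ b ∉ P.1) ↔ (a ∉ P.1 ∨ b ∉ P.1)
    rw [Order.Ideal.sup_mem_iff]
    tauto
  map_inf' a b := by
    ext P
    change (a ⊓ b ∉ P.1) ↔ (a ∉ P.1 ∧ b ∉ P.1)
    constructor
    · exact fun h => ⟨fun ha => h (P.1.lower inf_le_left ha), fun hb => h (P.1.lower inf_le_right hb)⟩
    · exact fun h hab => (P.2.mem_or_mem hab).elim h.1 h.2
  map_top' := by
    ext P
    have := P.2.toIsProper.top_notMem
    simpa using this
  map_bot' := by
    ext P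
    simp

variable {L} in
theorem stone_le_stone {a b : L} : stone L a ≤ stone L b ↔ a ≤ b := by
  constructor
  · intro h
    by_contra hab
    obtain ⟨J, hJ, hIJ, hd⟩ := DistribLattice.prime_ideal_of_disjoint_filter_ideal
      (F := Order.PFilter.principal a) (I := Order.Ideal.principal b) (by
        rw [Set.disjoint_left]
        intro x hx hx'
        exact hab ((Order.PFilter.mem_principal.1 hx).trans (Order.Ideal.mem_principal.1 hx')))
    have h1 : (⟨J, hJ⟩ : PrimeIdeals L) ∈ stone L a := fun haJ =>
      Set.disjoint_left.1 hd (Order.PFilter.mem_principal.2 le_rfl) haJ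
    exact h h1 (hIJ (Order.Ideal.mem_principal.2 le_rfl))
  · exact fun h => OrderHomClass.mono (stone L) h

/-- The free Boolean extension `Fr(L)`, as a Boolean subalgebra of the power set of the set of prime
ideals: the one generated by the Stone embedding of `L`. -/
def Fr : BooleanSubalgebra (Set (PrimeIdeals L)) :=
  BooleanSubalgebra.closure (Set.range (stone L))

/-- The embedding of `L` in `Fr(L)`. -/
def ofLattice : BoundedLatticeHom L (Fr L) where
  toFun a := ⟨stone L a, BooleanSubalgebra.subset_closure ⟨a, rfl⟩⟩
  map_sup' a b := Subtype.ext (map_sup (stone L) a b)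
  map_inf' a b := Subtype.ext (map_inf (stone L) a b)
  map_top' := Subtype.ext (map_top (stone L))
  map_bot' := Subtype.ext (map_bot (stone L))

variable {L}

theorem ofLattice_le_ofLattice {a b : L} : ofLattice L a ≤ ofLattice L b ↔ a ≤ b :=
  stone_le_stone

/-- Every element of `Fr(L)` has the form `(-u₁ + v₁) ⋯ (-uₙ + vₙ)` with all `uᵢ, vᵢ` in `L`. -/
theorem exists_rep (a : Fr L) : ∃ t : Finset (L × L),
    a = t.inf fun p => (ofLattice L p.1)ᶜ ⊔ ofLattice L p.2 := by
  classical
  have hsub : IsSublattice (Set.range (stone L)) :=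
    ⟨by rintro _ ⟨x, rfl⟩ _ ⟨y, rfl⟩; exact ⟨x ⊔ y, map_sup _ _ _⟩,
     by rintro _ ⟨x, rfl⟩ _ ⟨y, rfl⟩; exact ⟨x ⊓ y, map_inf _ _ _⟩⟩
  obtain ⟨t, ht⟩ := (BooleanSubalgebra.mem_closure_iff_sup_sdiff hsub ⟨⊥, map_bot _⟩
    ⟨⊤, map_top _⟩).1 (BooleanSubalgebra.compl_mem a.2)
  refine ⟨t.image fun x => (x.1.2.choose, x.2.2.choose), ?_⟩
  have key : aᶜ = t.sup fun x => ofLattice L x.1.2.choose \ ofLattice L x.2.2.choose := by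
    apply Subtype.ext
    have h2 : ∀ s : Finset (Set.range (stone L) × Set.range (stone L)),
        ((s.sup fun x => ofLattice L x.1.2.choose \ ofLattice L x.2.2.choose : Fr L) :
          Set (PrimeIdeals L)) = s.sup fun x => x.1.1 \ x.2.1 := by
      intro s
      induction s using Finset.induction_on with
      | empty => rfl
      | insert x s _ ih =>
        rw [Finset.sup_insert, Finset.sup_insert, BooleanSubalgebra.val_sup, ih]
        congr 1
        change stone L x.1.2.choose \ stone L x.2.2.choose = _
        rw [x.1.2.choose_spec, x.2.2.choose_spec]
    rw [h2]
    exact ht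
  rw [← compl_compl a, key, Finset.compl_sup, Finset.inf_image]
  congr 1
  funext x
  change (_ \ _)ᶜ = _ᶜ ⊔ _
  rw [sdiff_eq, compl_inf, compl_compl]

/-- The inverse image of a prime ideal under a bounded lattice homomorphism. -/
def comapPrime (h : BoundedLatticeHom L M) (P : PrimeIdeals M) : PrimeIdeals L :=
  ⟨{ carrier := {a | h a ∈ P.1}
     lower' := fun _ _ hab ha => P.1.lower (OrderHomClass.mono h hab) ha
     nonempty' := ⟨⊥, by simp⟩
     directed' := fun a ha b hb => ⟨a ⊔ b, by
       change h (a ⊔ b) ∈ P.1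
       rw [map_sup]
       exact Order.Ideal.sup_mem ha hb, le_sup_left, le_sup_right⟩ }, by
    have : Order.Ideal.IsProper ({ carrier := {a | h a ∈ P.1}
                                   lower' := fun _ _ hab ha => P.1.lower (OrderHomClass.mono h hab) ha
                                   nonempty' := ⟨⊥, by simp⟩
                                   directed' := fun a ha b hb => ⟨a ⊔ b, by
                                     change h (a ⊔ b) ∈ P.1
                                     rw [map_sup]
                                     exact Order.Ideal.sup_mem ha hb, le_sup_left,
                                       le_sup_right⟩ } : Order.Ideal L) := by
      apply Order.Ideal.isProper_of_notMem (p := ⊤)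
      change h ⊤ ∉ P.1
      rw [map_top]
      exact P.2.toIsProper.top_notMem
    apply Order.Ideal.IsPrime.of_mem_or_mem
    intro x y hxy
    change h (x ⊓ y) ∈ P.1 at hxy
    rw [map_inf] at hxy
    exact P.2.mem_or_mem hxy⟩

/-- The Boolean homomorphism of power sets induced by a bounded lattice homomorphism. -/
def powMap (h : BoundedLatticeHom L M) :
    BoundedLatticeHom (Set (PrimeIdeals L)) (Set (PrimeIdeals M)) where
  toFun S := comapPrime h ⁻¹' S
  map_sup' _ _ := rfl
  map_inf' _ _ := rfl
  map_top' := rfl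
  map_bot' := rfl

theorem powMap_stone (h : BoundedLatticeHom L M) (a : L) :
    powMap h (stone L a) = stone M (h a) := rfl

theorem powMap_mem (h : BoundedLatticeHom L M) (a : Fr L) : powMap h a ∈ Fr M := by
  have : Fr L ≤ (Fr M).comap (powMap h) := by
    refine BooleanSubalgebra.closure_le.2 ?_
    rintro _ ⟨a, rfl⟩
    exact BooleanSubalgebra.subset_closure ⟨h a, rfl⟩
  exact this a.2

/-- The Boolean homomorphism `Fr(L) → Fr(M)` induced by a bounded lattice homomorphism. -/
def frMap (h : BoundedLatticeHom L M) : BoundedLatticeHom (Fr L) (Fr M) where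
  toFun a := ⟨powMap h a, powMap_mem h a⟩
  map_sup' _ _ := rfl
  map_inf' _ _ := rfl
  map_top' := rfl
  map_bot' := rfl

theorem frMap_ofLattice (h : BoundedLatticeHom L M) (a : L) :
    frMap h (ofLattice L a) = ofLattice M (h a) := rfl

end FreeBooleanExtension

/-! ### The functor `B` from Heyting algebras to interior algebras -/

section FunctorB

variable {L : Type u} [HeytingAlgebra L] {M : Type v} [HeytingAlgebra M]

/-- `(u₁ ⇨ v₁) ⋯ (uₙ ⇨ vₙ)` in `L`, where `a = (-u₁ + v₁) ⋯ (-uₙ + vₙ)` in `Fr(L)`. The value does not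
depend on the representation of `a`, see `interiorElt_eq`. -/
noncomputable def interiorElt (a : Fr L) : L :=
  (exists_rep a).choose.inf fun p => p.1 ⇨ p.2

theorem ofLattice_le_rep (t : Finset (L × L)) (m : L) :
    ofLattice L m ≤ (t.inf fun p => (ofLattice L p.1)ᶜ ⊔ ofLattice L p.2) ↔
      m ≤ t.inf fun p => p.1 ⇨ p.2 := by
  rw [Finset.le_inf_iff, Finset.le_inf_iff]
  refine forall₂_congr fun p _ => ?_
  rw [le_himp_iff, ← ofLattice_le_ofLattice (a := m ⊓ p.1), map_inf, sup_comm, ← himp_eq,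
    le_himp_iff]

theorem ofLattice_le_iff (m : L) (a : Fr L) : ofLattice L m ≤ a ↔ m ≤ interiorElt a := by
  conv_lhs => rw [(exists_rep a).choose_spec]
  exact ofLattice_le_rep _ _

theorem interiorElt_eq (t : Finset (L × L)) :
    interiorElt (t.inf fun p => (ofLattice L p.1)ᶜ ⊔ ofLattice L p.2) =
      t.inf fun p => p.1 ⇨ p.2 :=
  eq_of_forall_le_iff fun m => by rw [← ofLattice_le_iff, ofLattice_le_rep]

theorem interiorElt_ofLattice (a : L) : interiorElt (ofLattice L a) = a :=
  eq_of_forall_le_iff fun m => by rw [← ofLattice_le_iff, ofLattice_le_ofLattice]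

/-- The interior algebra `B(L) = ⟨Fr(L), g_L⟩`. -/
noncomputable instance : InteriorAlgebra (Fr L) where
  int a := ofLattice L (interiorElt a)
  int_top := by
    have h : interiorElt (⊤ : Fr L) = ⊤ := top_le_iff.1 ((ofLattice_le_iff _ _).1 le_top)
    rw [h, map_top]
  int_inf a b := by
    rw [← map_inf]
    congr 1
    exact eq_of_forall_le_iff fun m => by
      rw [← ofLattice_le_iff, le_inf_iff, le_inf_iff, ofLattice_le_iff, ofLattice_le_iff]
  int_le a := (ofLattice_le_iff _ _).2 le_rfl
  int_int a := by rw [interiorElt_ofLattice]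

theorem int_eq (a : Fr L) : InteriorAlgebra.int a = ofLattice L (interiorElt a) := rfl

/-- A Heyting homomorphism as a bounded lattice homomorphism. -/
def toBdd (h : HeytingHom L M) : BoundedLatticeHom L M where
  toFun := h
  map_sup' := map_sup h
  map_inf' := map_inf h
  map_top' := map_top h
  map_bot' := map_bot h

/-- The homomorphism of interior algebras `B(L) → B(M)` induced by a Heyting homomorphism. -/
noncomputable def extend (h : HeytingHom L M) : InteriorHom (Fr L) (Fr M) :=
  { frMap (toBdd h) with
    map_int' := fun a => by
      change frMap (toBdd h) (ofLattice L (interiorElt a)) =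
        ofLattice M (interiorElt (frMap (toBdd h) a))
      rw [frMap_ofLattice]
      congr 1
      classical
      obtain ⟨t, rfl⟩ := exists_rep a
      have h1 : frMap (toBdd h) (t.inf fun p => (ofLattice L p.1)ᶜ ⊔ ofLattice L p.2) =
          (t.image fun p => (h p.1, h p.2)).inf
            fun p => (ofLattice M p.1)ᶜ ⊔ ofLattice M p.2 := by
        rw [Finset.inf_image, map_finset_inf]
        congr 1
      have h2 : toBdd h (t.inf fun p => p.1 ⇨ p.2) =
          (t.image fun p => (h p.1, h p.2)).inf fun p => p.1 ⇨ p.2 := by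
        rw [Finset.inf_image, map_finset_inf]
        congr 1
        funext p
        exact map_himp h p.1 p.2
      rw [h1, interiorElt_eq, interiorElt_eq, h2] }

/-- `extend h` is the unique homomorphism of interior algebras that extends `h`. -/
theorem extend_unique (h : HeytingHom L M) (k : InteriorHom (Fr L) (Fr M)) :
    (∀ a, k (ofLattice L a) = ofLattice M (h a)) ↔ k = extend h := by
  constructor
  · intro hk
    apply DFunLike.ext
    intro a
    obtain ⟨t, rfl⟩ := exists_rep a
    have hk' : ∀ x : L, k (ofLattice L x) = extend h (ofLattice L x) := hk
    rw [map_finset_inf, map_finset_inf]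
    congr 1
    funext p
    simp only [Function.comp, map_sup, map_compl', hk']
  · rintro rfl a
    rfl

end FunctorB

/-- The functor `B` from Heyting algebras to interior algebras. -/
noncomputable def BFunctor : HeytAlg.{u} ⥤ IntAlg.{u} where
  obj L := ⟨Fr L⟩
  map h := ConcreteCategory.ofHom (C := IntAlg) (extend (ConcreteCategory.hom h))
  map_id _ := rfl
  map_comp _ _ := rfl

/-! ### Terms, varieties, finite presentability, projectivity -/

/-- Terms in the signature of Heyting algebras. -/
inductive HTerm (X : Type) : Type
  | var : X → HTerm X
  | bot : HTerm X
  | top : HTerm X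
  | sup : HTerm X → HTerm X → HTerm X
  | inf : HTerm X → HTerm X → HTerm X
  | imp : HTerm X → HTerm X → HTerm X

/-- The value of a term in a Heyting algebra. -/
def HTerm.eval {X : Type} {A : Type u} [HeytingAlgebra A] (x : X → A) : HTerm X → A
  | var i => x i
  | bot => ⊥
  | top => ⊤
  | sup s t => s.eval x ⊔ t.eval x
  | inf s t => s.eval x ⊓ t.eval x
  | imp s t => s.eval x ⇨ t.eval x

/-- Terms in the signature of interior algebras. -/
inductive ITerm (X : Type) : Type
  | var : X → ITerm X
  | bot : ITerm X
  | top : ITerm X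
  | sup : ITerm X → ITerm X → ITerm X
  | inf : ITerm X → ITerm X → ITerm X
  | compl : ITerm X → ITerm X
  | int : ITerm X → ITerm X

/-- The value of a term in an interior algebra. -/
def ITerm.eval {X : Type} {A : Type u} [InteriorAlgebra A] (x : X → A) : ITerm X → A
  | var i => x i
  | bot => ⊥
  | top => ⊤
  | sup s t => s.eval x ⊔ t.eval x
  | inf s t => s.eval x ⊓ t.eval x
  | compl s => (s.eval x)ᶜ
  | int s => InteriorAlgebra.int (s.eval x)

/-- A class of Heyting algebras is a variety if it is defined by a set of equations. -/
def IsHeytingVariety (V : ObjectProperty HeytAlg.{u}) : Prop :=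
  ∃ E : Set (HTerm ℕ × HTerm ℕ),
    ∀ A : HeytAlg.{u}, V A ↔ ∀ e ∈ E, ∀ x : ℕ → A, e.1.eval x = e.2.eval x

/-- The variety of interior algebras generated by a class `K`: all interior algebras that satisfy
every equation which holds throughout `K`. -/
def generatedVariety (K : ObjectProperty IntAlg.{u}) : ObjectProperty IntAlg.{u} := fun A =>
  ∀ s t : ITerm ℕ, (∀ B : IntAlg.{u}, K B → ∀ x : ℕ → B, s.eval x = t.eval x) →
    ∀ x : ℕ → A, s.eval x = t.eval x

/-- `ρ*(V)`, the variety generated by the interior algebras `B(L)` for `L` in `V`. -/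
def rhoStar (V : ObjectProperty HeytAlg.{u}) : ObjectProperty IntAlg.{u} :=
  generatedVariety fun A => ∃ L : HeytAlg.{u}, V L ∧ A = BFunctor.obj L

/-- A class of interior algebras is locally finite if each finitely generated subalgebra of a
member is finite. The subalgebra generated by `a₁, …, aₙ` consists of the values of the terms
in `n` variables. -/
def IsLocallyFinite (W : ObjectProperty IntAlg.{u}) : Prop :=
  ∀ A : IntAlg.{u}, W A → ∀ (n : ℕ) (a : Fin n → A),
    (Set.range fun t : ITerm (Fin n) => t.eval a).Finite

/-- The Heyting algebra `A` is finitely presented in the class `V`: it belongs to `V` and is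
presented in `V` by finitely many generators `a₁, …, aₙ` and finitely many relations. -/
def HeytingFinPresented (V : ObjectProperty HeytAlg.{u}) (A : HeytAlg.{u}) : Prop :=
  V A ∧ ∃ (n : ℕ) (R : Set (HTerm (Fin n) × HTerm (Fin n))) (a : Fin n → A), R.Finite ∧
    (∀ r ∈ R, r.1.eval a = r.2.eval a) ∧
    ∀ C : HeytAlg.{u}, V C → ∀ c : Fin n → C, (∀ r ∈ R, r.1.eval c = r.2.eval c) →
      ∃! h : A ⟶ C, ∀ i, h (a i) = c i

/-- The interior algebra `A` is finitely presented in the class `W`. -/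
def InteriorFinPresented (W : ObjectProperty IntAlg.{u}) (A : IntAlg.{u}) : Prop :=
  W A ∧ ∃ (n : ℕ) (R : Set (ITerm (Fin n) × ITerm (Fin n))) (a : Fin n → A), R.Finite ∧
    (∀ r ∈ R, r.1.eval a = r.2.eval a) ∧
    ∀ C : IntAlg.{u}, W C → ∀ c : Fin n → C, (∀ r ∈ R, r.1.eval c = r.2.eval c) →
      ∃! h : A ⟶ C, ∀ i, h (a i) = c i

section Projective

variable {𝒞 : Type v} [Category.{w} 𝒞] {FC : 𝒞 → 𝒞 → Type*} {CC : 𝒞 → Type*}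
  [∀ X Y, FunLike (FC X Y) (CC X) (CC Y)] [ConcreteCategory 𝒞 FC]

/-- `P` is projective in the class `V`: it belongs to `V`, and homomorphisms from `P` lift along
surjective homomorphisms between members of `V`. -/
def IsProjectiveIn (V : ObjectProperty 𝒞) (P : 𝒞) : Prop :=
  V P ∧ ∀ A B : 𝒞, V A → V B → ∀ f : A ⟶ B, Function.Surjective f → ∀ g : P ⟶ B,
    ∃ k : P ⟶ A, k ≫ f = g

end Projective

/-! ### Unifiers -/

/-- `⟨u, M⟩` is a unifier in `V` of the Heyting algebra `L`. -/
def IsHeytingUnifier (V : ObjectProperty HeytAlg.{u}) {L M : HeytAlg.{u}} (_u : L ⟶ M) : Prop :=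
  HeytingFinPresented V M ∧ IsProjectiveIn V M

/-- `⟨w, N⟩` is a unifier in `W` of the interior algebra `A`. -/
def IsInteriorUnifier (W : ObjectProperty IntAlg.{u}) {A N : IntAlg.{u}} (_w : A ⟶ N) : Prop :=
  InteriorFinPresented W N ∧ IsProjectiveIn W N

/-- `L` is unifiable relative to `V`: it is finitely presented in `V` and has a unifier. -/
def IsUnifiable (V : ObjectProperty HeytAlg.{u}) (L : HeytAlg.{u}) : Prop :=
  HeytingFinPresented V L ∧ ∃ (M : HeytAlg.{u}) (u : L ⟶ M), IsHeytingUnifier V u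

/-- `⟨u, M⟩` is more general than `⟨v, N⟩`. -/
def MoreGeneral {𝒞 : Type v} [Category.{w} 𝒞] {A M N : 𝒞} (u : A ⟶ M) (v : A ⟶ N) : Prop :=
  ∃ h : M ⟶ N, u ≫ h = v

end HeytingUnification

open HeytingUnification

namespace HeytingUnification

/-! ### Open elements of an interior algebra, and the universal property of `B(L)`. -/

section Open

variable {A : Type u} {B : Type v} [InteriorAlgebra A] [InteriorAlgebra B]

open InteriorAlgebra

/-! The functor `B` is left adjoint to `Opens`: a homomorphism `B(L) → A` is the same as a Heyting
homomorphism from `L` to the open elements of `A` (`OpenHom.lift`, `fr_hom_ext`). The open elements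
of `B(L)` are exactly `L`, so `B` is full and faithful, and injectivity and preservation of the
quasiorder are formal. The Gödel translation shows that `Opens` maps `ρ*(V)` into `V` (`opens_mem`);
since `Opens` also preserves surjections, `B` carries finite presentations and projectivity from `V`
to `ρ*(V)`.

Surjectivity needs more, since an interior algebra need not be generated by its open elements. Every
`B(L)` satisfies the Grzegorczyk law (`grzegorczyk`), hence so does every member of `ρ*(V)`. In a
finite algebra the law makes each atom a difference of two open elements, so `B(Opens N) → N` is
bijective (`lift_val_bijective`). Under local finiteness every finitely presented `N` is finite, and
`Opens N` is the required target. -/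

theorem int_mono {a b : A} (h : a ≤ b) : int a ≤ int b := by
  rw [← inf_eq_left, ← int_inf, inf_eq_left.2 h]

theorem le_int_iff {a b : A} (ha : int a = a) : a ≤ int b ↔ a ≤ b :=
  ⟨fun h => h.trans (int_le b), fun h => ha.symm.le.trans (int_mono h)⟩

theorem int_finset_inf {ι : Type*} (t : Finset ι) (f : ι → A) :
    int (t.inf f) = t.inf fun i => int (f i) := by
  classical
  induction t using Finset.induction_on with
  | empty => exact int_top
  | insert i t _ ih => rw [Finset.inf_insert, Finset.inf_insert, int_inf, ih]

variable (A) in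
/-- The sublattice of open elements of an interior algebra. -/
def Opens : Sublattice A where
  carrier := {a | int a = a}
  supClosed' _ ha _ hb := le_antisymm (int_le _) (sup_le
    (ha.symm.le.trans (int_mono le_sup_left)) (hb.symm.le.trans (int_mono le_sup_right)))
  infClosed' a ha b hb := (int_inf a b).trans (congrArg₂ _ ha hb)

theorem int_mem_opens (a : A) : int a ∈ Opens A := int_int a

instance : BoundedOrder (Opens A) where
  top := ⟨⊤, int_top⟩
  bot := ⟨⊥, le_bot_iff.1 (int_le _)⟩
  le_top a := Subtype.coe_le_coe.1 (le_top : (a : A) ≤ ⊤)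
  bot_le a := Subtype.coe_le_coe.1 (bot_le : ⊥ ≤ (a : A))

/-- The open elements of an interior algebra form a Heyting algebra. -/
instance : HeytingAlgebra (Opens A) :=
  HeytingAlgebra.ofHImp (fun a b => ⟨int ((a : A)ᶜ ⊔ b), int_mem_opens _⟩) fun a b c => by
    rw [← Subtype.coe_le_coe, ← Subtype.coe_le_coe, le_int_iff a.2, sup_comm, ← himp_eq,
      le_himp_iff]
    rfl

/-- Bounded lattice homomorphisms from a Heyting algebra to an interior algebra which send `a ⇨ b`
to the interior of `-a + b`; equivalently, Heyting homomorphisms to the algebra of open elements. -/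
structure OpenHom (L : Type u) (A : Type v) [HeytingAlgebra L] [InteriorAlgebra A] extends
    BoundedLatticeHom L A where
  map_himp' : ∀ a b : L, toFun (a ⇨ b) = int ((toFun a)ᶜ ⊔ toFun b)

namespace OpenHom

variable {L : Type w} [HeytingAlgebra L]

instance : FunLike (OpenHom L A) L A where
  coe f := f.toFun
  coe_injective f g h := by
    obtain ⟨f, _⟩ := f
    obtain ⟨g, _⟩ := g
    congr
    exact DFunLike.coe_injective h

instance : BoundedLatticeHomClass (OpenHom L A) L A where
  map_sup f := f.map_sup'
  map_inf f := f.map_inf'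
  map_top f := f.map_top'
  map_bot f := f.map_bot'

protected theorem map_himp (k : OpenHom L A) (a b : L) : k (a ⇨ b) = int ((k a)ᶜ ⊔ k b) :=
  k.map_himp' a b

/-- Write `a` as `⊤ ⇨ a`, whose image is an interior by definition. -/
theorem int_apply (k : OpenHom L A) (a : L) : int (k a) = k a := by
  conv_rhs => rw [← top_himp (a := a), k.map_himp, map_top, compl_top, bot_sup_eq]

variable (A) in
/-- The inclusion of the open elements. -/
def val : OpenHom (Opens A) A where
  toFun := Subtype.val
  map_sup' _ _ := rfl
  map_inf' _ _ := rfl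
  map_top' := rfl
  map_bot' := rfl
  map_himp' _ _ := rfl

variable (L) in
/-- The embedding of `L` in `B(L)`. -/
noncomputable def unit : OpenHom L (Fr L) :=
  { ofLattice L with
    map_himp' := fun a b => by
      have := interiorElt_eq ({(a, b)} : Finset (L × L))
      rw [Finset.inf_singleton, Finset.inf_singleton] at this
      change ofLattice L (a ⇨ b) = ofLattice L _
      rw [← this]
      rfl }

/-- Composition with a homomorphism of interior algebras. -/
def postcomp (g : InteriorHom A B) (k : OpenHom L A) : OpenHom L B :=
  { g.toBoundedLatticeHom.comp k.toBoundedLatticeHom with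
    map_himp' := fun a b => by
      change g (k (a ⇨ b)) = int ((g (k a))ᶜ ⊔ g (k b))
      rw [k.map_himp, g.map_int, map_sup, map_compl'] }

/-- Composition with a Heyting homomorphism. -/
def precomp {M : Type*} [HeytingAlgebra M] (k : OpenHom L A) (h : HeytingHom M L) :
    OpenHom M A :=
  { k.toBoundedLatticeHom.comp (toBdd h) with
    map_himp' := fun a b => by
      change k (h (a ⇨ b)) = int ((k (h a))ᶜ ⊔ k (h b))
      rw [HeytingHomClass.map_himp h, k.map_himp] }

/-- If `k = j ∘ r` with `j` injective, then `r` is a Heyting homomorphism. -/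
def factor {M : Type*} [HeytingAlgebra M] (k : OpenHom M A) (j : OpenHom L A)
    (hj : Function.Injective j) (r : M → L) (hr : ∀ a, j (r a) = k a) : HeytingHom M L where
  toFun := r
  map_sup' a b := hj (by rw [map_sup, hr, hr, hr, map_sup])
  map_inf' a b := hj (by rw [map_inf, hr, hr, hr, map_inf])
  map_bot' := hj (by rw [hr, map_bot, map_bot])
  map_himp' a b := hj (by rw [hr, k.map_himp, j.map_himp, hr, hr])

/-- An open-valued homomorphism as a Heyting homomorphism to the algebra of open elements. -/
def toOpens (k : OpenHom L A) : HeytingHom L (Opens A) :=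
  factor k (val A) Subtype.val_injective (fun a => ⟨k a, k.int_apply a⟩) fun _ => rfl

end OpenHom

theorem ofLattice_injective {L : Type u} [DistribLattice L] [BoundedOrder L] :
    Function.Injective (ofLattice L) := fun _ _ h =>
  le_antisymm (ofLattice_le_ofLattice.1 h.le) (ofLattice_le_ofLattice.1 h.ge)

/-- In a Boolean algebra `u ⇨ v` already is `-u + v`. So `ofLattice A` is an isomorphism with
inverse `interiorElt`, which lets `frLift` return from `Fr A` to `A`. -/
theorem ofLattice_interiorElt_of_booleanAlgebra {A : Type u} [BooleanAlgebra A] (a : Fr A) :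
    ofLattice A (interiorElt a) = a := by
  obtain ⟨t, rfl⟩ := exists_rep a
  rw [interiorElt_eq, map_finset_inf]
  congr 1
  funext p
  rw [Function.comp, himp_eq, map_sup, map_compl', sup_comm]

section Boolean

variable {L : Type w} [DistribLattice L] [BoundedOrder L] {A : Type u} [BooleanAlgebra A]

/-- The extension of a bounded lattice homomorphism to the free Boolean extension. -/
noncomputable def frLift (k : BoundedLatticeHom L A) : BoundedLatticeHom (Fr L) A where
  toFun a := interiorElt (frMap k a)
  map_sup' a b := ofLattice_injective (by
    simp only [map_sup, ofLattice_interiorElt_of_booleanAlgebra])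
  map_inf' a b := ofLattice_injective (by
    simp only [map_inf, ofLattice_interiorElt_of_booleanAlgebra])
  map_top' := ofLattice_injective (by
    simp only [map_top, ofLattice_interiorElt_of_booleanAlgebra])
  map_bot' := ofLattice_injective (by
    simp only [map_bot, ofLattice_interiorElt_of_booleanAlgebra])

theorem frLift_ofLattice (k : BoundedLatticeHom L A) (a : L) :
    frLift k (ofLattice L a) = k a :=
  interiorElt_ofLattice (k a)

end Boolean

theorem map_rep {L : Type w} [DistribLattice L] [BoundedOrder L] {F : Type*} [FunLike F (Fr L) A]
    [BoundedLatticeHomClass F (Fr L) A] (f : F) (t : Finset (L × L)) :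
    f (t.inf fun p => (ofLattice L p.1)ᶜ ⊔ ofLattice L p.2) =
      t.inf fun p => (f (ofLattice L p.1))ᶜ ⊔ f (ofLattice L p.2) := by
  rw [map_finset_inf]
  congr 1
  funext p
  simp only [Function.comp, map_sup, map_compl']

variable {L : Type w} [HeytingAlgebra L]

/-- The extension of an open-valued homomorphism on `L` to a homomorphism on `B(L)`. -/
noncomputable def OpenHom.lift (k : OpenHom L A) : InteriorHom (Fr L) A :=
  { frLift k.toBoundedLatticeHom with
    map_int' := fun a => by
      change frLift k.toBoundedLatticeHom (ofLattice L (interiorElt a)) =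
        int (frLift k.toBoundedLatticeHom a)
      obtain ⟨t, rfl⟩ := exists_rep a
      rw [interiorElt_eq, map_rep, int_finset_inf, frLift_ofLattice, map_finset_inf]
      congr 1
      funext p
      rw [frLift_ofLattice, frLift_ofLattice]
      exact k.map_himp p.1 p.2 }

theorem OpenHom.lift_ofLattice (k : OpenHom L A) (a : L) : k.lift (ofLattice L a) = k a :=
  frLift_ofLattice _ a

theorem fr_hom_ext {f g : InteriorHom (Fr L) A} (h : ∀ a, f (ofLattice L a) = g (ofLattice L a)) :
    f = g := by
  apply DFunLike.ext
  intro a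
  obtain ⟨t, rfl⟩ := exists_rep a
  simp only [map_rep, h]

/-- If `a` is sent to `⊤`, so is its interior, which lies in `L`, where `k` is injective. Hence only
`⊤` goes to `⊤`, and this suffices for a Boolean homomorphism. -/
theorem lift_injective {k : OpenHom L A} (hk : Function.Injective k) :
    Function.Injective k.lift := by
  have key : ∀ a : Fr L, k.lift a = ⊤ → a = ⊤ := by
    intro a ha
    have h1 : k.lift (int a) = ⊤ := by rw [k.lift.map_int, ha, int_top]
    rw [int_eq, k.lift_ofLattice, ← map_top k] at h1
    have h2 : int a = ⊤ := by rw [int_eq, hk h1, map_top]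
    exact top_le_iff.1 (h2.symm.le.trans (int_le a))
  have hle : ∀ a b : Fr L, k.lift a ≤ k.lift b → a ≤ b := by
    intro a b h
    rw [← himp_eq_top_iff]
    apply key
    rw [himp_eq, map_sup, map_compl', ← himp_eq, himp_eq_top_iff]
    exact h
  exact fun a b h => le_antisymm (hle a b h.le) (hle b a h.ge)

/-- The Heyting homomorphism of algebras of open elements induced by a homomorphism. -/
def opensMap (f : InteriorHom A B) : HeytingHom (Opens A) (Opens B) :=
  ((OpenHom.val A).postcomp f).toOpens

theorem coe_opensMap (f : InteriorHom A B) (a : Opens A) : (opensMap f a : B) = f a := rfl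

/-- A preimage of an open element need not be open, but its interior is another preimage. -/
theorem opensMap_surjective {f : InteriorHom A B} (hf : Function.Surjective f) :
    Function.Surjective (opensMap f) := by
  intro b
  obtain ⟨a, ha⟩ := hf b
  refine ⟨⟨int a, int_mem_opens a⟩, Subtype.ext ?_⟩
  rw [coe_opensMap, f.map_int, ha]
  exact b.2

/-- The restriction of a homomorphism `B(L) → B(M)` to the open elements. -/
noncomputable def restrict {M : Type*} [HeytingAlgebra M] (f : InteriorHom (Fr L) (Fr M)) :
    HeytingHom L M :=
  ((OpenHom.unit L).postcomp f).factor (OpenHom.unit M) ofLattice_injective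
    (fun a => interiorElt (f (ofLattice L a)))
    fun a => (((OpenHom.unit L).postcomp f).int_apply a)

theorem ofLattice_restrict {M : Type*} [HeytingAlgebra M] (f : InteriorHom (Fr L) (Fr M)) (a : L) :
    ofLattice M (restrict f a) = f (ofLattice L a) :=
  ((OpenHom.unit L).postcomp f).int_apply a

theorem extend_ofLattice {M : Type*} [HeytingAlgebra M] (h : HeytingHom L M) (a : L) :
    extend h (ofLattice L a) = ofLattice M (h a) := rfl

theorem extend_restrict {M : Type*} [HeytingAlgebra M] (f : InteriorHom (Fr L) (Fr M)) :
    extend (restrict f) = f :=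
  ((extend_unique _ _).1 fun a => (ofLattice_restrict f a).symm).symm

theorem extend_surjective {M : Type*} [HeytingAlgebra M] {h : HeytingHom L M}
    (hh : Function.Surjective h) : Function.Surjective (extend h) := by
  classical
  intro b
  obtain ⟨t, rfl⟩ := exists_rep b
  choose s hs using hh
  refine ⟨t.inf fun p => (ofLattice L (s p.1))ᶜ ⊔ ofLattice L (s p.2), ?_⟩
  rw [map_finset_inf]
  congr 1
  funext p
  simp only [Function.comp, map_sup, map_compl', extend_ofLattice, hs]

end Open

/-! ### The Grzegorczyk law and generation by open elements. -/

section Grzegorczyk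

open InteriorAlgebra

/-- The Grzegorczyk law for `B(L)`, relative to an open element. -/
theorem le_of_inf_int_le {L : Type u} [HeytingAlgebra L] (a : L) (p : Fr L)
    (h : ofLattice L a ⊓ int (pᶜ ⊔ int p) ≤ p) : ofLattice L a ≤ p := by
  have hopen : ∀ b : L, int (ofLattice L b) = ofLattice L b := (OpenHom.unit L).int_apply
  -- an open element on which `p` vanishes off an open part of `p` lies below `p`
  have hstep : ∀ b e : L, b ≤ a → ofLattice L e ≤ p → ofLattice L b ≤ pᶜ ⊔ ofLattice L e →
      ofLattice L b ≤ p := by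
    intro b e hba he hb
    refine (le_inf (ofLattice_le_ofLattice.2 hba) ?_).trans h
    rw [le_int_iff (hopen b)]
    exact hb.trans (sup_le_sup_left ((le_int_iff (hopen e)).2 he) _)
  -- Induction on the number of factors. The invariant: below `b` and modulo the open part `e` of
  -- `p`, the element `p` agrees with the meet over `t`.
  have key : ∀ (t : Finset (L × L)) (b e : L), b ≤ a → ofLattice L e ≤ p →
      (ofLattice L b ⊓ (t.inf fun q => (ofLattice L q.1)ᶜ ⊔ ofLattice L q.2) ≤
        p ⊔ ofLattice L e) →
      (ofLattice L b ⊓ p ≤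
        (t.inf fun q => (ofLattice L q.1)ᶜ ⊔ ofLattice L q.2) ⊔ ofLattice L e) →
      ofLattice L b ≤ p := by
    classical
    intro t
    induction t using Finset.induction_on with
    | empty =>
      intro b e hb he h1 _
      rw [Finset.inf_empty, inf_top_eq, sup_eq_left.2 he] at h1
      exact h1
    | insert q t _ ih =>
      obtain ⟨x, y⟩ := q
      intro b e hb he h1 h2
      rw [Finset.inf_insert] at h1 h2
      generalize (t.inf fun q => (ofLattice L q.1)ᶜ ⊔ ofLattice L q.2) = r at h1 h2 ih
      -- Below `y` the factor `-x + y` is `⊤`, so it can be dropped.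
      have hy : ofLattice L (b ⊓ y) ≤ p := by
        refine ih _ e (inf_le_left.trans hb) he ?_ ?_
        · refine le_trans ?_ h1
          rw [map_inf]
          exact le_inf (inf_le_left.trans inf_le_left)
            (le_inf ((inf_le_left.trans inf_le_right).trans le_sup_right) inf_le_right)
        · rw [map_inf]
          exact (inf_le_inf_right _ inf_le_left).trans
            (h2.trans (sup_le_sup_right inf_le_right _))
      -- Below `b ⊓ x`, the factor forces `p` into `y` modulo `e`. So `p` lies there in `e ⊔ b ⊓ y`,
      -- an open part of `p` by `hy`, and `hstep` applies.
      have hx : ofLattice L (b ⊓ x) ≤ p := by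
        refine hstep _ (e ⊔ b ⊓ y) (inf_le_left.trans hb) ?_ ?_
        · rw [map_sup]; exact sup_le he hy
        · rw [map_sup, map_inf, map_inf, sup_comm, ← himp_eq, le_himp_iff]
          have h3 : ofLattice L b ⊓ ofLattice L x ⊓ p ≤
              ((ofLattice L x)ᶜ ⊔ ofLattice L y) ⊔ ofLattice L e :=
            (inf_le_inf_right _ inf_le_left).trans (h2.trans (sup_le_sup_right inf_le_left _))
          have h4 : ofLattice L b ⊓ ofLattice L x ⊓ p ≤
              (((ofLattice L x)ᶜ ⊔ ofLattice L y) ⊔ ofLattice L e) ⊓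
                (ofLattice L b ⊓ ofLattice L x) := le_inf h3 inf_le_left
          refine h4.trans ?_
          rw [inf_sup_right, inf_sup_right]
          refine sup_le (sup_le ?_ ?_) (inf_le_left.trans le_sup_left)
          · rw [inf_left_comm, compl_inf_self, inf_bot_eq]
            exact bot_le
          · exact le_trans (le_inf (inf_le_right.trans inf_le_left) inf_le_left) le_sup_right
      -- Now `b ⊓ x` can be absorbed into `e`; off `x` the factor is again `⊤`.
      refine ih b (e ⊔ b ⊓ x) hb ?_ ?_ ?_
      · rw [map_sup]; exact sup_le he hx
      · rw [map_sup, map_inf]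
        have h5 : ofLattice L b ⊓ r ≤
            (ofLattice L b ⊓ (((ofLattice L x)ᶜ ⊔ ofLattice L y) ⊓ r)) ⊔
              (ofLattice L b ⊓ ofLattice L x) := by
          calc ofLattice L b ⊓ r
              ≤ ofLattice L b ⊓ r ⊓ ((ofLattice L x)ᶜ ⊔ ofLattice L x) := by
                rw [compl_sup_eq_top, inf_top_eq]
            _ ≤ _ := by
                rw [inf_sup_left]
                refine sup_le_sup ?_ (inf_le_inf_right _ inf_le_left)
                exact le_inf (inf_le_left.trans inf_le_left)
                  (le_inf (inf_le_right.trans le_sup_left) (inf_le_left.trans inf_le_right))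
        refine h5.trans (sup_le (h1.trans (sup_le_sup_left le_sup_left _)) ?_)
        exact le_sup_right.trans le_sup_right
      · rw [map_sup]
        exact h2.trans (sup_le_sup inf_le_right le_sup_left)
  obtain ⟨t, ht⟩ := exists_rep p
  refine key t a ⊥ le_rfl ?_ ?_ ?_
  · rw [map_bot]; exact bot_le
  · rw [← ht]; exact inf_le_right.trans le_sup_left
  · rw [← ht]; exact inf_le_right.trans le_sup_left

/-- The left side is open, and its meet with `int (pᶜ ⊔ int p)` is below `p` by modus ponens. -/
theorem grzegorczyk {L : Type u} [HeytingAlgebra L] (p : Fr L) :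
    int ((int (pᶜ ⊔ int p))ᶜ ⊔ p) ≤ p := by
  apply le_of_inf_int_le
  calc int ((int (pᶜ ⊔ int p))ᶜ ⊔ p) ⊓ int (pᶜ ⊔ int p)
      ≤ ((int (pᶜ ⊔ int p))ᶜ ⊔ p) ⊓ int (pᶜ ⊔ int p) := inf_le_inf_right _ (int_le _)
    _ ≤ p := by rw [inf_sup_right, compl_inf_self, bot_sup_eq]; exact inf_le_left

variable {N : Type u} [InteriorAlgebra N]

/-- Apply the law to `p = xᶜ`. If the atom `x` missed `int (x ⊔ int xᶜ)`, the left side would be `⊤`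
and force `xᶜ = ⊤`; so `x` lies below it. Removing `int xᶜ` from `x ⊔ int xᶜ` leaves nothing outside
`x`. -/
theorem eq_sdiff_of_isAtom
    (hN : ∀ p : N, int ((int (pᶜ ⊔ int p))ᶜ ⊔ p) ≤ p) {x : N} (hx : IsAtom x) :
    x = int (x ⊔ int xᶜ) ⊓ (int xᶜ)ᶜ := by
  have h := hN xᶜ
  rw [compl_compl] at h
  have h1 : x ≤ int (x ⊔ int xᶜ) := by
    rcases hx.le_iff.1 (inf_le_left : x ⊓ int (x ⊔ int xᶜ) ≤ x) with h0 | h0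
    · have : (int (x ⊔ int xᶜ))ᶜ ⊔ xᶜ = ⊤ := by
        rw [← compl_inf, inf_comm, h0, compl_bot]
      rw [this, int_top, top_le_iff, compl_eq_top] at h
      exact absurd h hx.1
    · exact inf_eq_left.1 h0
  apply le_antisymm
  · exact le_inf h1 (le_compl_comm.1 (int_le _))
  · calc int (x ⊔ int xᶜ) ⊓ (int xᶜ)ᶜ ≤ (x ⊔ int xᶜ) ⊓ (int xᶜ)ᶜ :=
          inf_le_inf_right _ (int_le _)
      _ ≤ x := by rw [inf_sup_right, inf_compl_self, sup_bot_eq]; exact inf_le_left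

theorem mem_of_isAtom_mem {A : Type u} [BooleanAlgebra A] [Finite A]
    (S : BooleanSubalgebra A) (hS : ∀ x : A, IsAtom x → x ∈ S) (a : A) : a ∈ S := by
  induction a using WellFoundedLT.induction with
  | ind a ih =>
    rcases eq_bot_or_exists_atom_le a with rfl | ⟨x, hx, hxa⟩
    · exact S.bot_mem
    · rw [← sup_sdiff_cancel_right hxa]
      exact S.sup_mem (hS x hx) (ih _ (sdiff_lt hxa hx.1))

/-- A finite interior algebra with the Grzegorczyk law is generated by its open elements. -/
theorem lift_val_bijective [Finite N] (hN : ∀ p : N, int ((int (pᶜ ⊔ int p))ᶜ ⊔ p) ≤ p) :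
    Function.Bijective (OpenHom.val N).lift := by
  -- Injectivity holds for every `N`; finiteness and the law serve surjectivity only.
  refine ⟨lift_injective Subtype.val_injective, fun a => ?_⟩
  have hop : ∀ b : N, int b ∈ Set.range (OpenHom.val N).lift := fun b =>
    ⟨ofLattice _ ⟨int b, int_mem_opens b⟩, OpenHom.lift_ofLattice _ _⟩
  let S : BooleanSubalgebra N :=
    { carrier := Set.range (OpenHom.val N).lift
      supClosed' := by rintro _ ⟨x, rfl⟩ _ ⟨y, rfl⟩; exact ⟨x ⊔ y, map_sup _ _ _⟩
      infClosed' := by rintro _ ⟨x, rfl⟩ _ ⟨y, rfl⟩; exact ⟨x ⊓ y, map_inf _ _ _⟩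
      compl_mem' := by rintro _ ⟨x, rfl⟩; exact ⟨xᶜ, map_compl' _ _⟩
      bot_mem' := ⟨⊥, map_bot _⟩ }
  refine mem_of_isAtom_mem S (fun x hx => ?_) a
  rw [eq_sdiff_of_isAtom hN hx]
  exact S.inf_mem (hop _) (S.compl_mem (hop _))

end Grzegorczyk

section Unification

open InteriorAlgebra

/-! ### The Gödel translation. -/

section Terms

/-- The Gödel translation of Heyting terms. -/
def HTerm.translate {X : Type} : HTerm X → ITerm X
  | var i => .int (.var i)
  | bot => .bot
  | top => .top
  | sup s t => .sup s.translate t.translate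
  | inf s t => .inf s.translate t.translate
  | imp s t => .int (.sup (.compl s.translate) t.translate)

/-- Variables are translated with an interior in front, so only `int (x i)` matters. The hypothesis
thus covers both open `x i` and arbitrary elements of `B(L)`. -/
theorem HTerm.eval_translate {X : Type} {L : Type u} {A : Type v} [HeytingAlgebra L]
    [InteriorAlgebra A] (k : OpenHom L A) {x : X → A} {y : X → L} (h : ∀ i, int (x i) = k (y i))
    (t : HTerm X) : t.translate.eval x = k (t.eval y) := by
  induction t with
  | var i => exact h i
  | bot => exact (map_bot k).symm
  | top => exact (map_top k).symm
  | sup s t hs ht => simp only [translate, ITerm.eval, eval, map_sup, hs, ht]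
  | inf s t hs ht => simp only [translate, ITerm.eval, eval, map_inf, hs, ht]
  | imp s t hs ht => simp only [translate, ITerm.eval, eval, k.map_himp, hs, ht]

theorem InteriorHom.map_eval {X : Type} {A : Type u} {B : Type v} [InteriorAlgebra A]
    [InteriorAlgebra B] (f : InteriorHom A B) (x : X → A) (t : ITerm X) :
    f (t.eval x) = t.eval fun i => f (x i) := by
  induction t with
  | var i => rfl
  | bot => exact map_bot f
  | top => exact map_top f
  | sup s t hs ht => simp only [ITerm.eval, map_sup, hs, ht]
  | inf s t hs ht => simp only [ITerm.eval, map_inf, hs, ht]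
  | compl s hs => simp only [ITerm.eval, map_compl', hs]
  | int s hs => simp only [ITerm.eval, f.map_int, hs]

end Terms

/-! ### Equations that pass to `ρ*(V)`. -/

section Varieties

variable {V : ObjectProperty HeytAlg.{u}}

theorem generatedVariety_of_injective {K : ObjectProperty IntAlg.{u}} {A B : IntAlg.{u}}
    (hB : generatedVariety K B) (f : InteriorHom A B) (hf : Function.Injective f) :
    generatedVariety K A := fun s t h x => hf (by
  rw [f.map_eval, f.map_eval]
  exact hB s t h _)

theorem rhoStar_obj {L : HeytAlg.{u}} (hL : V L) : rhoStar V (BFunctor.obj L) :=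
  fun _ _ h x => h _ ⟨L, hL, rfl⟩ x

/-- The translation of an equation of `V` holds in each `B(L)` under all assignments, because it
sees only their interiors, which lie in `L`. Hence it holds in `A`, where on open elements it says
the original equation. -/
theorem opens_mem (hV : IsHeytingVariety V) {A : IntAlg.{u}} (hA : rhoStar V A) :
    V (HeytAlg.of (Opens A)) := by
  obtain ⟨E, hE⟩ := hV
  rw [hE]
  intro e he x
  apply Subtype.val_injective
  have h := hA e.1.translate e.2.translate ?_ (fun i => (x i : A))
  · have hx : ∀ i, int (x i : A) = OpenHom.val A (x i) := fun i => (x i).2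
    rw [HTerm.eval_translate (OpenHom.val A) hx, HTerm.eval_translate (OpenHom.val A) hx] at h
    exact h
  · rintro _ ⟨L, hL, rfl⟩ z
    have hz : ∀ i, int (z i) = OpenHom.unit L (interiorElt (z i)) := fun i => rfl
    refine (HTerm.eval_translate (OpenHom.unit L) hz _).trans
      (Eq.trans ?_ (HTerm.eval_translate (OpenHom.unit L) hz _).symm)
    rw [(hE L).1 hL e he]

theorem grzegorczyk_of_rhoStar {A : IntAlg.{u}} (hA : rhoStar V A) (p : A) :
    int ((int (pᶜ ⊔ int p))ᶜ ⊔ p) ≤ p := by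
  let p₀ : ITerm ℕ := .var 0
  let g : ITerm ℕ := .int (.sup (.compl (.int (.sup (.compl p₀) (.int p₀)))) p₀)
  -- The inequality `g ≤ p` as an equation, so that it passes to the generated variety.
  have h := hA (.inf g p₀) g ?_ fun _ => p
  · exact inf_eq_left.1 h
  · rintro _ ⟨L, -, rfl⟩ x
    exact inf_eq_left.2 (grzegorczyk (L := L) (x 0))

end Varieties

/-! ### Generated subalgebras. -/

section Subalgebra

variable {X : Type} {A : Type u} [InteriorAlgebra A] (a : X → A)

/-- The subalgebra generated by a family. -/
def generated : BooleanSubalgebra A where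
  carrier := Set.range fun t : ITerm X => t.eval a
  supClosed' := by rintro _ ⟨s, rfl⟩ _ ⟨t, rfl⟩; exact ⟨s.sup t, rfl⟩
  infClosed' := by rintro _ ⟨s, rfl⟩ _ ⟨t, rfl⟩; exact ⟨s.inf t, rfl⟩
  compl_mem' := by rintro _ ⟨s, rfl⟩; exact ⟨s.compl, rfl⟩
  bot_mem' := ⟨.bot, rfl⟩

theorem int_mem_generated {b : A} (hb : b ∈ generated a) : int b ∈ generated a := by
  obtain ⟨t, rfl⟩ := hb
  exact ⟨t.int, rfl⟩

instance : InteriorAlgebra (generated a) where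
  int b := ⟨int b.1, int_mem_generated a b.2⟩
  int_top := Subtype.ext int_top
  int_inf b c := Subtype.ext (int_inf b.1 c.1)
  int_le b := int_le b.1
  int_int b := Subtype.ext (int_int b.1)

/-- The inclusion of the subalgebra generated by a family. -/
def generatedVal : InteriorHom (generated a) A where
  toFun := Subtype.val
  map_sup' _ _ := rfl
  map_inf' _ _ := rfl
  map_top' := rfl
  map_bot' := rfl
  map_int' _ := rfl

end Subalgebra

/-! ### Finite presentability and projectivity under `B`. -/

section FinPresented

variable {V : ObjectProperty HeytAlg.{u}}

/-- The universal property gives a map from `A` to the subalgebra generated by `a`. Followed by the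
inclusion it fixes the generators, so it is the identity by uniqueness. -/
theorem InteriorFinPresented.exists_generators {K : ObjectProperty IntAlg.{u}} {A : IntAlg.{u}}
    (hA : InteriorFinPresented (generatedVariety K) A) :
    ∃ (n : ℕ) (a : Fin n → A), ∀ b : A, ∃ t : ITerm (Fin n), t.eval a = b := by
  obtain ⟨hA, n, R, a, -, hR, huniv⟩ := hA
  refine ⟨n, a, ?_⟩
  let S : IntAlg.{u} := ⟨generated a⟩
  let ι : S ⟶ A := ConcreteCategory.ofHom (C := IntAlg) (generatedVal a)
  have hι : Function.Injective (generatedVal a) := Subtype.val_injective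
  have hS : generatedVariety K S := generatedVariety_of_injective hA (generatedVal a) hι
  let c : Fin n → S := fun i => ⟨a i, .var i, rfl⟩
  obtain ⟨h, hc, -⟩ := huniv S hS c fun r hr => hι (by
    rw [InteriorHom.map_eval, InteriorHom.map_eval]
    exact hR r hr)
  have hid : h ≫ ι = 𝟙 A :=
    (huniv A hA a hR).unique (fun i => congrArg (generatedVal a) (hc i)) fun _ => rfl
  intro b
  obtain ⟨t, ht⟩ := (h b).2
  refine ⟨t, ht.trans ?_⟩
  exact congrArg (fun f : A ⟶ A => f b) hid

theorem HeytingFinPresented.of_finite {A : HeytAlg.{u}} (hA : V A) [Finite A] :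
    HeytingFinPresented V A := by
  obtain ⟨n, ⟨e⟩⟩ := Finite.exists_equiv_fin A
  let x : A → HTerm (Fin n) := fun a => .var (e a)
  -- The operation tables, with one generator per element; `⊤` needs no relation, being `⊥ ⇨ ⊥`.
  let R : Set (HTerm (Fin n) × HTerm (Fin n)) :=
    {(.bot, x ⊥)} ∪ Set.range (fun p : A × A => (.sup (x p.1) (x p.2), x (p.1 ⊔ p.2))) ∪
      Set.range (fun p : A × A => (.inf (x p.1) (x p.2), x (p.1 ⊓ p.2))) ∪
      Set.range (fun p : A × A => (.imp (x p.1) (x p.2), x (p.1 ⇨ p.2)))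
  refine ⟨hA, n, R, e.symm, ?_, ?_, ?_⟩
  · exact (((Set.finite_singleton _).union (Set.finite_range _)).union
      (Set.finite_range _)).union (Set.finite_range _)
  · rintro r (((rfl | ⟨p, rfl⟩) | ⟨p, rfl⟩) | ⟨p, rfl⟩) <;> simp [x, HTerm.eval]
  · intro C _ c hc
    let h : HeytingHom A C :=
      { toFun := fun a => c (e a)
        map_bot' := (hc (.bot, x ⊥) (.inl (.inl (.inl rfl)))).symm
        map_sup' := fun a b => (hc (.sup (x a) (x b), x (a ⊔ b))
          (.inl (.inl (.inr ⟨(a, b), rfl⟩)))).symm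
        map_inf' := fun a b => (hc (.inf (x a) (x b), x (a ⊓ b))
          (.inl (.inr ⟨(a, b), rfl⟩))).symm
        map_himp' := fun a b => (hc (.imp (x a) (x b), x (a ⇨ b)) (.inr ⟨(a, b), rfl⟩)).symm }
    refine ⟨ConcreteCategory.ofHom (C := HeytAlg) h, fun i => ?_, fun k hk => ?_⟩
    · exact congrArg c (e.apply_symm_apply i)
    · ext a
      have := hk (e a)
      rw [e.symm_apply_apply] at this
      exact this

theorem HeytingFinPresented.obj (hV : IsHeytingVariety V) {M : HeytAlg.{u}}
    (hM : HeytingFinPresented V M) : InteriorFinPresented (rhoStar V) (BFunctor.obj M) := by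
  obtain ⟨hM, n, R, a, hfin, hR, huniv⟩ := hM
  -- The extra relations make the generators open, so a solution in `C` is a solution of `R` in
  -- `Opens C`.
  refine ⟨rhoStar_obj hM, n, (fun r => (r.1.translate, r.2.translate)) '' R ∪
    Set.range (fun i => (.int (.var i), .var i)), fun i => ofLattice M (a i),
    (hfin.image _).union (Set.finite_range _), ?_, ?_⟩
  · rintro r (⟨r, hr, rfl⟩ | ⟨i, rfl⟩)
    · have ha : ∀ i, int (ofLattice M (a i)) = OpenHom.unit M (a i) :=
        fun i => (OpenHom.unit M).int_apply (a i)
      refine (HTerm.eval_translate (OpenHom.unit M) ha _).trans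
        (Eq.trans ?_ (HTerm.eval_translate (OpenHom.unit M) ha _).symm)
      rw [hR r hr]
    · exact (OpenHom.unit M).int_apply (a i)
  · intro C hC c hc
    let c' : Fin n → Opens C := fun i => ⟨c i, hc _ (.inr ⟨i, rfl⟩)⟩
    have hc' : ∀ i, int (c i) = OpenHom.val C (c' i) := fun i => (c' i).2
    obtain ⟨h, hh, huniq⟩ := huniv (HeytAlg.of (Opens C)) (opens_mem hV hC) c' fun r hr =>
      Subtype.val_injective (by
        have := hc _ (.inl ⟨r, hr, rfl⟩)
        rw [HTerm.eval_translate (OpenHom.val C) hc',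
          HTerm.eval_translate (OpenHom.val C) hc'] at this
        exact this)
    refine ⟨ConcreteCategory.ofHom (C := IntAlg)
      ((OpenHom.val C).precomp (ConcreteCategory.hom (C := HeytAlg) h)).lift, fun i => ?_, fun k hk => ?_⟩
    · exact (OpenHom.lift_ofLattice _ _).trans (congrArg Subtype.val (hh i))
    · apply ConcreteCategory.hom_ext (C := IntAlg)
      have hk' : ConcreteCategory.ofHom (C := HeytAlg)
          ((OpenHom.unit M).postcomp (ConcreteCategory.hom (C := IntAlg) k)).toOpens = h :=
        huniq _ fun i => Subtype.ext (hk i)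
      refine DFunLike.congr_fun (fr_hom_ext (L := M) (f := ConcreteCategory.hom (C := IntAlg) k) fun b => ?_)
      refine Eq.trans ?_ (OpenHom.lift_ofLattice _ _).symm
      rw [← hk']
      rfl

/-- Transpose the lifting problem to open elements, solve it in `V`, and transpose back. -/
theorem IsProjectiveIn.obj (hV : IsHeytingVariety V) {M : HeytAlg.{u}}
    (hM : IsProjectiveIn V M) : IsProjectiveIn (rhoStar V) (BFunctor.obj M) := by
  refine ⟨rhoStar_obj hM.1, fun A B hA hB f hf g => ?_⟩
  obtain ⟨k, hk⟩ := hM.2 (HeytAlg.of (Opens A)) (HeytAlg.of (Opens B)) (opens_mem hV hA)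
    (opens_mem hV hB) (ConcreteCategory.ofHom (C := HeytAlg) (opensMap (ConcreteCategory.hom f)))
    (opensMap_surjective hf)
    (ConcreteCategory.ofHom (C := HeytAlg)
      ((OpenHom.unit M).postcomp (ConcreteCategory.hom (C := IntAlg) g)).toOpens)
  refine ⟨ConcreteCategory.ofHom (C := IntAlg)
    ((OpenHom.val A).precomp (ConcreteCategory.hom (C := HeytAlg) k)).lift, ?_⟩
  apply ConcreteCategory.hom_ext (C := IntAlg)
  refine DFunLike.congr_fun (fr_hom_ext (L := M) (g := ConcreteCategory.hom (C := IntAlg) g) fun b => ?_)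
  refine (congrArg (ConcreteCategory.hom f) (OpenHom.lift_ofLattice _ b)).trans ?_
  exact congrArg (fun e : M ⟶ HeytAlg.of (Opens B) => (ConcreteCategory.hom e b).1) hk

end FinPresented

/-! ### `B` is full and faithful and reflects projectivity. -/

section Functor

theorem BFunctor_map_injective {L M : HeytAlg.{u}} {f g : L ⟶ M}
    (h : BFunctor.map f = BFunctor.map g) : f = g := by
  ext a
  exact ofLattice_injective (congrArg
    (fun e : BFunctor.obj L ⟶ BFunctor.obj M => ConcreteCategory.hom e (ofLattice L a)) h)

instance : BFunctor.{u}.Faithful := ⟨BFunctor_map_injective⟩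

instance : BFunctor.{u}.Full where
  map_surjective g := ⟨ConcreteCategory.ofHom (C := HeytAlg) (restrict (ConcreteCategory.hom (C := IntAlg) g)),
    ConcreteCategory.hom_ext (C := IntAlg) _ _
      (DFunLike.congr_fun (extend_restrict (ConcreteCategory.hom (C := IntAlg) g)))⟩

/-- A bijective homomorphism of interior algebras is an isomorphism. -/
noncomputable def IntAlg.isoOfBijective {A B : IntAlg.{u}} (f : InteriorHom A B)
    (hf : Function.Bijective f) : A ≅ B :=
  let e := Equiv.ofBijective f hf
  have he : ∀ b, f (e.symm b) = b := e.apply_symm_apply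
  { hom := ConcreteCategory.ofHom (C := IntAlg) f
    inv := ConcreteCategory.ofHom (C := IntAlg)
      { toFun := e.symm
        map_sup' := fun a b => hf.1 ((he _).trans (by rw [map_sup, he, he]))
        map_inf' := fun a b => hf.1 ((he _).trans (by rw [map_inf, he, he]))
        map_top' := hf.1 (by rw [he, map_top])
        map_bot' := hf.1 (by rw [he, map_bot])
        map_int' := fun a => hf.1 (by rw [f.map_int]; exact (he _).trans (by rw [he])) }
    hom_inv_id := ConcreteCategory.hom_ext (C := IntAlg) _ _ e.symm_apply_apply
    inv_hom_id := ConcreteCategory.hom_ext (C := IntAlg) _ _ e.apply_symm_apply }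

/-- `B` preserves surjections, so the lift exists in `ρ*(V)`; fullness brings it back to `V`. -/
theorem IsProjectiveIn.of_obj_iso {V : ObjectProperty HeytAlg.{u}} {M : HeytAlg.{u}} (hM : V M)
    {N : IntAlg.{u}} (hN : IsProjectiveIn (rhoStar V) N) (φ : BFunctor.obj M ≅ N) :
    IsProjectiveIn V M := by
  refine ⟨hM, fun A B hA hB f hf g => ?_⟩
  obtain ⟨k, hk⟩ := hN.2 _ _ (rhoStar_obj hA) (rhoStar_obj hB) (BFunctor.map f)
    (extend_surjective hf) (φ.inv ≫ BFunctor.map g)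
  refine ⟨BFunctor.preimage (φ.hom ≫ k), BFunctor.map_injective ?_⟩
  rw [BFunctor.map_comp, BFunctor.map_preimage, Category.assoc, hk, Iso.hom_inv_id_assoc]

end Functor

end Unification

end HeytingUnification

/-! ### The main theorem. -/

theorem mainTheorem5 (V : ObjectProperty HeytAlg.{u})
    (hV : IsHeytingVariety V) (L : HeytAlg.{u})
    (hL : IsUnifiable V L) :
    -- `τ` is well defined: `B(L)` is finitely presented, and images of unifiers are unifiers
    InteriorFinPresented (rhoStar V)
      (BFunctor.obj L) ∧
    (∀ (M : HeytAlg.{u}) (f : L ⟶ M), IsHeytingUnifier V f →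
      IsInteriorUnifier (rhoStar V)
        (BFunctor.map f)) ∧
    -- `τ` is injective: each isomorphism of the images of two unifiers comes from a unique
    -- isomorphism of the unifiers; and unifiers with the same target and the same image are equal
    (∀ (M₀ M₁ : HeytAlg.{u}) (f₀ : L ⟶ M₀) (f₁ : L ⟶ M₁),
      IsHeytingUnifier V f₀ → IsHeytingUnifier V f₁ →
      ∀ φ : BFunctor.obj M₀ ≅ BFunctor.obj M₁,
        BFunctor.map f₀ ≫ φ.hom = BFunctor.map f₁ →
        ∃! ψ : M₀ ≅ M₁, f₀ ≫ ψ.hom = f₁ ∧ BFunctor.map ψ.hom = φ.hom) ∧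
    (∀ (M : HeytAlg.{u}) (f₀ f₁ : L ⟶ M), IsHeytingUnifier V f₀ → IsHeytingUnifier V f₁ →
      BFunctor.map f₀ = BFunctor.map f₁ → f₀ = f₁) ∧
    -- `τ` preserves the quasiorder
    (∀ (M₀ M₁ : HeytAlg.{u}) (f₀ : L ⟶ M₀) (f₁ : L ⟶ M₁),
      IsHeytingUnifier V f₀ → IsHeytingUnifier V f₁ →
      MoreGeneral f₀ f₁ →
      MoreGeneral (BFunctor.map f₀)
        (BFunctor.map f₁)) ∧
    -- if `ρ*(V)` is locally finite, then `τ` is surjective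
    (IsLocallyFinite (rhoStar V) →
      ∀ (N : IntAlg.{u}) (g : BFunctor.obj L ⟶ N),
        IsInteriorUnifier (rhoStar V) g →
        ∃ (M : HeytAlg.{u}) (f : L ⟶ M), IsHeytingUnifier V f ∧
          ∃ φ : BFunctor.obj M ≅ N,
            BFunctor.map f ≫ φ.hom = g) := by
  refine ⟨hL.1.obj hV, fun M f hf => ⟨hf.1.obj hV, hf.2.obj hV⟩, ?_,
    fun M f₀ f₁ _ _ h => BFunctor.map_injective h, ?_, ?_⟩
  · intro M₀ M₁ f₀ f₁ _ _ φ hφ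
    refine ⟨BFunctor.preimageIso φ, ⟨BFunctor.map_injective ?_, BFunctor.map_preimage _⟩, ?_⟩
    · rw [BFunctor.map_comp, BFunctor.preimageIso_hom, BFunctor.map_preimage, hφ]
    · rintro ψ ⟨-, hψ⟩
      exact Iso.ext (BFunctor.map_injective (by
        rw [hψ, BFunctor.preimageIso_hom, BFunctor.map_preimage]))
  · rintro M₀ M₁ f₀ f₁ _ _ ⟨h, rfl⟩
    exact ⟨BFunctor.map h, (BFunctor.map_comp _ _).symm⟩
  · rintro hfin N g ⟨hN, hproj⟩
    have : Finite N := by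
      obtain ⟨n, a, ha⟩ := hN.exists_generators
      exact Set.finite_univ_iff.1 ((hfin N hN.1 n a).subset fun b _ => ha b)
    -- Up to isomorphism the only choice, since the open elements of `B(M)` form a copy of `M`.
    let M : HeytAlg.{u} := HeytAlg.of (Opens N)
    have hM : V M := opens_mem hV hN.1
    have : Finite M := inferInstanceAs (Finite (Opens N))
    let φ : BFunctor.obj M ≅ N := IntAlg.isoOfBijective (OpenHom.val N).lift
      (lift_val_bijective (grzegorczyk_of_rhoStar hN.1))
    refine ⟨M, BFunctor.preimage (g ≫ φ.inv),
      ⟨HeytingFinPresented.of_finite hM, IsProjectiveIn.of_obj_iso hM hproj φ⟩, φ, ?_⟩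
    rw [BFunctor.map_preimage, Category.assoc, Iso.inv_hom_id, Category.comp_id]
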